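/- Let $d\ge 0$ be an integer. For $n\ge 0$ let $P_n(x)=\frac{1}{2^n n!}\frac{d^n}{dx^n}(x^2-1)^n$ be the Legendre polynomial and, for $0\le m\le n$, let $P_n^m(x)=(-1)^m(1-x^2)^{m/2}\frac{d^m}{dx^m}P_n(x)$ be the associated Legendre function. The real spherical harmonics are $$Y_n^0(\theta,\phi)=\sqrt{2n+1}\,P_n^0(\cos\theta),$$ $$Y_n^m(\theta,\phi)=\sqrt{2(2n+1)\tfrac{(n-m)!}{(n+m)!}}\,P_n^m(\cos\theta)\cos(m\phi)\quad(1\le m\le n),$$ $$Y_n^{m}(\theta,\phi)=\sqrt{2(2n+1)\tfrac{(n-|m|)!}{(n+|m|)!}}\,P_n^{|m|}(\cos\theta)\sin(m\phi)\quad(-n\le m\le -1).$$ Let $f_d(\theta,\phi)\in\mathbb R^{(d+1)^2}$ be the vector of all $Y_\ell^m(\theta,\phi)$ with $0\le\ell\le d$, $-\ell\le m\le\ell$. A design is a Borel probability measure $\xi$ on $[0,\pi]\times(-\pi,\pi]$; its information matrix is $M(\xi)=\int f_d f_d^T\,d\xi$, a symmetric positive semidefinite matrix with eigenvalues $0\le\lambda_{(1)}(M(\xi))\le\dots\le\lambda_{((d+1)^2)}(M(\xi))$,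 counted with multiplicity. For $p\in[-\infty,1)$ and $1\le r\le (d+1)^2$ put $$\Psi_{p,r}(\xi)=\Big(\sum_{j=1}^r\lambda_{(j)}(M(\xi))^p\Big)^{1/p}\quad(p\ne 0,-\infty),$$ $$\Psi_{0,r}(\xi)=\prod_{j=1}^r\lambda_{(j)}(M(\xi)),\qquad \Psi_{-\infty,r}(\xi)=\lambda_{(1)}(M(\xi)),$$ where for $-\infty<p<0$ the conventions $0^p=\infty$ and $\infty^{1/p}=0$ are used (so that $\Psi_{p,r}(\xi)=0$ if $M(\xi)$ is singular). A design is called $\Psi_{p,r}$-optimal if it maximizes $\Psi_{p,r}$ among all designs. **Corollary 2.2.** For every integer $d\ge0$, every $p\in[-\infty,1)$ and every integer $r$ with $1\le r\le(d+1)^2$, the uniform distribution on the sphere, $$\xi^*(d\theta,d\phi)=\frac{1}{4\pi}\sin\theta\,d\theta\,d\phi\quad\text{on }[0,\pi]\times(-\pi,\pi],$$ is a $\Psi_{p,r}$-optimal design. -/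

import Mathlib

open scoped ENNReal

noncomputable section

namespace SphericalDesign

open MeasureTheory

/-- The Legendre polynomial `P_n`, by Rodrigues' formula. -/
def legendre (n : ℕ) : Polynomial ℝ :=
  Polynomial.C (1 / (2 ^ n * (n.factorial : ℝ))) *
    Polynomial.derivative^[n] ((Polynomial.X ^ 2 - 1) ^ n)

/-- The associated Legendre function
`P_n^m(x) = (-1)^m (1 - x^2)^(m/2) (d/dx)^m P_n(x)` for `m ≥ 0` (with the factor `(-1)^m`). -/
def assocLegendre (n m : ℕ) (x : ℝ) : ℝ :=
  (-1) ^ m * Real.sqrt (1 - x ^ 2) ^ m * (Polynomial.derivative^[m] (legendre n)).eval x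

/-- The real spherical harmonic `Y_n^m(θ, φ)` for `-n ≤ m ≤ n`, normalized to have mean square
one with respect to the uniform distribution on the sphere. -/
def sphericalHarmonic (n : ℕ) (m : ℤ) (θ φ : ℝ) : ℝ :=
  if m = 0 then
    Real.sqrt (2 * n + 1) * assocLegendre n 0 (Real.cos θ)
  else if 0 < m then
    Real.sqrt (2 * (2 * n + 1) * ((n - m.natAbs).factorial : ℝ) / ((n + m.natAbs).factorial : ℝ)) *
      assocLegendre n m.natAbs (Real.cos θ) * Real.cos (m * φ)
  else
    Real.sqrt (2 * (2 * n + 1) * ((n - m.natAbs).factorial : ℝ) / ((n + m.natAbs).factorial : ℝ)) *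
      assocLegendre n m.natAbs (Real.cos θ) * Real.sin (m * φ)

/-- The pairs `(ℓ, m)` with `0 ≤ ℓ ≤ d` and `-ℓ ≤ m ≤ ℓ`; there are `(d + 1)^2` of them. -/
abbrev Index (d : ℕ) : Type :=
  Σ ℓ : Fin (d + 1), ↥(Finset.Icc (-((ℓ : ℕ) : ℤ)) ((ℓ : ℕ) : ℤ))

/-- The vector `f_d(θ, φ)` of all spherical harmonics of degree at most `d`, at `z = (θ, φ)`. -/
def regressionVector (d : ℕ) (z : ℝ × ℝ) : Index d → ℝ :=
  fun i => sphericalHarmonic (i.1 : ℕ) (i.2 : ℤ) z.1 z.2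

/-- The design region `[0, π] × (-π, π]`. -/
def designRegion : Set (ℝ × ℝ) :=
  Set.Icc 0 Real.pi ×ˢ Set.Ioc (-Real.pi) Real.pi

/-- An approximate design: a Borel probability measure concentrated on `[0, π] × (-π, π]`. -/
structure IsDesign (ξ : Measure (ℝ × ℝ)) : Prop where
  isProbabilityMeasure : IsProbabilityMeasure ξ
  compl_designRegion : ξ designRegionᶜ = 0

/-- The information matrix `M(ξ) = ∫ f_d f_dᵀ dξ`. -/
def infoMatrix (d : ℕ) (ξ : Measure (ℝ × ℝ)) : Matrix (Index d) (Index d) ℝ :=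
  Matrix.of fun i j => ∫ z, regressionVector d z i * regressionVector d z j ∂ξ

theorem infoMatrix_isHermitian (d : ℕ) (ξ : Measure (ℝ × ℝ)) :
    (infoMatrix d ξ).IsHermitian := by
  ext i j
  simp [infoMatrix, mul_comm]

/-- The `j`-th smallest eigenvalue (`1 ≤ j ≤ card ι`, counted with multiplicity) of a real
symmetric matrix; the value for other `j` is irrelevant. Note that `eigenvalues₀` lists the
eigenvalues in decreasing order, starting at index `0`. -/
def nthSmallestEigenvalue {ι : Type*} [Fintype ι] [DecidableEq ι] {A : Matrix ι ι ℝ}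
    (hA : A.IsHermitian) (j : ℕ) : ℝ :=
  if h : 1 ≤ j ∧ j ≤ Fintype.card ι then
    hA.eigenvalues₀ ⟨Fintype.card ι - j, by omega⟩
  else 0

/-- `λ_(j)(M(ξ))` as an element of `[0, ∞]` (information matrices are positive semidefinite). -/
def lam (d : ℕ) (ξ : Measure (ℝ × ℝ)) (j : ℕ) : ℝ≥0∞ :=
  ENNReal.ofReal (nthSmallestEigenvalue (infoMatrix_isHermitian d ξ) j)

/-- The criterion `Ψ_{p,r}(ξ)` with values in `[0, ∞]`. For `p < 0` the usual conventions
`0 ^ p = ∞` and `∞ ^ (1 / p) = 0` are in force, so that `Ψ_{p,r}(ξ) = 0` if `M(ξ)` is singular. -/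
def Psi (d : ℕ) (p : EReal) (r : ℕ) (ξ : Measure (ℝ × ℝ)) : ℝ≥0∞ :=
  if p = ⊥ then lam d ξ 1
  else if p = 0 then ∏ j ∈ Finset.Icc 1 r, lam d ξ j
  else (∑ j ∈ Finset.Icc 1 r, lam d ξ j ^ p.toReal) ^ (1 / p.toReal)

/-- `ξ₀` is a `Ψ_{p,r}`-optimal design: it maximizes `Ψ_{p,r}` among all designs. -/
def IsPsiOptimal (d : ℕ) (p : EReal) (r : ℕ) (ξ₀ : Measure (ℝ × ℝ)) : Prop :=
  IsDesign ξ₀ ∧ ∀ ξ : Measure (ℝ × ℝ), IsDesign ξ → Psi d p r ξ ≤ Psi d p r ξ₀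

/-- The uniform distribution on the sphere in the coordinates `(θ, φ)`:
the measure `sin θ dθ dφ / (4 π)` on `[0, π] × (-π, π]`. -/
def uniformDesign : Measure (ℝ × ℝ) :=
  (volume.restrict designRegion).withDensity
    fun z => ENNReal.ofReal (Real.sin z.1 / (4 * Real.pi))

end SphericalDesign

end

/-!
The uniform distribution on the sphere is optimal because its information matrix is the identity,
while the trace of the information matrix is the same for all designs.

* The harmonics are orthonormal (`infoMatrix_uniformDesign`), so all eigenvalues for the uniform
  distribution are equal to one.
* By the addition theorem the regression vector has constant squared length `(d + 1)^2`
  (`sum_regressionVector_sq`). Hence the `(d + 1)^2` eigenvalues of any information matrix, which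
  are nonnegative, have mean one (`trace_infoMatrix`), and the `r` smallest ones have mean at most
  one (`sum_nthSmallestEigenvalue_le`). Power means of exponent `p < 1` do not exceed the arithmetic
  mean (`prod_le_one_of_sum_le_card`, `sum_rpow_le_card`, `card_le_sum_rpow`).

Both facts about harmonics come from Legendre's equation differentiated `m` times, in the divergence
form `derivative_weight_mul_legendre`. It shows that the derivative of
`P_n^2 + 2 ∑ (n - m)! / (n + m)! (P_n^m)^2` telescopes to zero, which is the addition theorem
`legendre_addition`. It also allows an integration by parts that lowers the order `m` in the
integrals of `P_n^m P_k^m` (`legendreIntegral_succ`), which gives their orthogonality in the degree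
and relates their norms for different `m`. The norm of `P_n` itself then follows by integrating the
addition theorem over `[-1, 1]`.
-/

namespace SphericalDesign

open MeasureTheory

/-! ### Legendre polynomials -/

section Legendre

open Polynomial

/-- The power `u = (x^2 - 1)^n` satisfies `(x^2 - 1) u' = 2 n x u`; this is the derivative of order
`k + 1` of that identity. -/
theorem iterate_derivative_X_sq_sub_one_pow (n k : ℕ) :
    (X ^ 2 - 1) * derivative^[k + 2] ((X ^ 2 - 1 : ℝ[X]) ^ n) +
        2 * ((k : ℝ[X]) + 1 - (n : ℝ[X])) * X * derivative^[k + 1] ((X ^ 2 - 1 : ℝ[X]) ^ n) +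
        ((k : ℝ[X]) + 1) * ((k : ℝ[X]) - 2 * (n : ℝ[X])) *
          derivative^[k] ((X ^ 2 - 1 : ℝ[X]) ^ n) = 0 := by
  induction k with
  | zero =>
    have h : (X ^ 2 - 1 : ℝ[X]) * derivative ((X ^ 2 - 1 : ℝ[X]) ^ n) =
        2 * (n : ℝ[X]) * X * (X ^ 2 - 1) ^ n := by
      rcases n with _ | n
      · simp
      · simp [derivative_pow, C_ofNat]
        ring
    have h' := congrArg derivative h
    simp only [derivative_mul, derivative_natCast, derivative_ofNat, derivative_sub,
      derivative_X_pow, derivative_one, derivative_X] at h'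
    simp [C_ofNat] at h' ⊢
    linear_combination h'
  | succ k ih =>
    have h' := congrArg derivative ih
    simp only [derivative_mul, derivative_add, derivative_natCast, derivative_ofNat,
      derivative_sub, derivative_X_pow, derivative_one, derivative_X, derivative_zero,
      ← Function.iterate_succ_apply' derivative] at h'
    simp only [Function.iterate_succ_apply'] at h' ⊢
    simp [-Function.iterate_succ, C_ofNat] at h'
    push_cast
    linear_combination h'

/-- The `m`-th derivative of Legendre's differential equation. By Rodrigues' formula it is the case
`k = n + m` of `iterate_derivative_X_sq_sub_one_pow`, up to a constant. -/
theorem legendre_ode (n m : ℕ) :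
    (1 - X ^ 2) * derivative^[m + 2] (legendre n) -
        2 * ((m : ℝ[X]) + 1) * X * derivative^[m + 1] (legendre n) +
        ((n : ℝ[X]) - (m : ℝ[X])) * ((n : ℝ[X]) + (m : ℝ[X]) + 1) *
          derivative^[m] (legendre n) = 0 := by
  have h := iterate_derivative_X_sq_sub_one_pow n (m + n)
  have e (k : ℕ) : derivative^[k] (legendre n) = C (1 / (2 ^ n * (n.factorial : ℝ))) *
      derivative^[k + n] ((X ^ 2 - 1 : ℝ[X]) ^ n) := by
    rw [legendre, iterate_derivative_C_mul, Function.iterate_add_apply]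
  rw [e, e, e, show m + 2 + n = m + n + 2 by ring, show m + 1 + n = m + n + 1 by ring]
  push_cast at h
  linear_combination -(C (1 / (2 ^ n * (n.factorial : ℝ)))) * h

theorem iterate_derivative_legendre_eq_zero (n : ℕ) :
    derivative^[n + 1] (legendre n) = 0 := by
  rw [legendre, iterate_derivative_C_mul, ← Function.iterate_add_apply,
    iterate_derivative_eq_zero, mul_zero]
  have h : natDegree ((X ^ 2 - 1 : ℝ[X]) ^ n) ≤ n * 2 :=
    natDegree_pow_le_of_le n (by compute_degree)
  omega

theorem legendre_eval_one (n : ℕ) : (legendre n).eval 1 = 1 := by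
  -- The value is read off from the Taylor expansion of `(x^2 - 1)^n` at `1`.
  have h : (derivative^[n] ((X ^ 2 - 1 : ℝ[X]) ^ n)).eval 1 = n.factorial * 2 ^ n := by
    have h1 := congrArg (eval 1) (congrFun (factorial_smul_hasseDeriv (R := ℝ) (k := n))
      ((X ^ 2 - 1 : ℝ[X]) ^ n))
    rw [← h1]
    have h2 : taylor 1 ((X ^ 2 - 1 : ℝ[X]) ^ n) = X ^ n * (X + 2) ^ n := by
      rw [taylor_pow, ← mul_pow]
      congr 1
      simp [taylor_apply]
      ring
    have h3 : (hasseDeriv n ((X ^ 2 - 1 : ℝ[X]) ^ n)).eval 1 = 2 ^ n := by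
      rw [← taylor_coeff, h2, coeff_X_pow_mul', if_pos le_rfl, Nat.sub_self,
        coeff_zero_eq_eval_zero]
      simp
    simp [h3]
  rw [legendre, eval_mul, eval_C, h]
  field_simp

/-- Legendre's equation in divergence form. It serves both the addition theorem and the
orthogonality relations. -/
theorem derivative_weight_mul_legendre (n m : ℕ) :
    derivative ((1 - X ^ 2) ^ (m + 1) * derivative^[m + 1] (legendre n)) =
      -(((n : ℝ[X]) - (m : ℝ[X])) * ((n : ℝ[X]) + (m : ℝ[X]) + 1) *
        ((1 - X ^ 2) ^ m * derivative^[m] (legendre n))) := by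
  have h := legendre_ode n m
  simp only [Function.iterate_succ_apply'] at h ⊢
  simp [derivative_pow, C_ofNat]
  linear_combination (1 - X ^ 2) ^ m * h

/-- The weight `2 (n - m)! / (n + m)!` of `(P_n^m)^2` in the addition theorem, for `1 ≤ m ≤ n`. The
formula gives `2` for `m = 0`, where the addition theorem has weight `1`. -/
noncomputable def harmonicWeight (n m : ℕ) : ℝ :=
  2 * ((n - m).factorial : ℝ) / ((n + m).factorial : ℝ)

theorem harmonicWeight_zero (n : ℕ) : harmonicWeight n 0 = 2 := by
  simp [harmonicWeight, Nat.factorial_ne_zero]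

theorem harmonicWeight_pos (n m : ℕ) : 0 < harmonicWeight n m := by
  unfold harmonicWeight
  positivity

theorem harmonicWeight_succ {n m : ℕ} (h : m < n) :
    harmonicWeight n (m + 1) * (((n : ℝ) - m) * (n + m + 1)) = harmonicWeight n m := by
  obtain ⟨k, rfl⟩ := Nat.exists_eq_add_of_lt h
  have h1 : m + k + 1 - (m + 1) = k := by omega
  have h2 : m + k + 1 - m = k + 1 := by omega
  rw [harmonicWeight, harmonicWeight, h1, h2, ← Nat.add_assoc (m + k + 1) m 1,
    Nat.factorial_succ (m + k + 1 + m), Nat.factorial_succ k]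
  push_cast
  field_simp
  ring

/-- The sum telescopes after differentiation: the divergence form of Legendre's equation turns the
derivative of each term into a difference. -/
theorem derivative_addition_partial_sum (n k : ℕ) (hk : k ≤ n) :
    derivative (legendre n ^ 2 + ∑ m ∈ Finset.range k, C (harmonicWeight n (m + 1)) *
        ((1 - X ^ 2) ^ (m + 1) * derivative^[m + 1] (legendre n) ^ 2)) =
      C (harmonicWeight n k) *
        ((1 - X ^ 2) ^ k * derivative^[k] (legendre n) * derivative^[k + 1] (legendre n)) := by
  induction k with
  | zero =>
    simp [harmonicWeight_zero, derivative_pow, C_ofNat]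
    ring
  | succ k ih =>
    have h1 := derivative_weight_mul_legendre n k
    have h2 := congrArg (C : ℝ →+* ℝ[X]) (harmonicWeight_succ (n := n) (m := k) (by omega))
    simp only [map_mul, map_sub, map_add, map_natCast, map_one] at h2
    rw [Finset.sum_range_succ, ← add_assoc, derivative_add, ih (by omega), derivative_C_mul,
      pow_two (derivative^[k + 1] _), ← mul_assoc ((1 - X ^ 2) ^ (k + 1)), derivative_mul, h1,
      ← h2, ← Function.iterate_succ_apply' derivative]
    ring

/-- The addition theorem on the diagonal: `P_n^2 + ∑ 2 (n - m)! / (n + m)! (P_n^m)^2 = 1`, with the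
sum over `1 ≤ m ≤ n`. The left-hand side has derivative zero, as `P_n` has degree at most `n`, and
takes the value `P_n(1)^2 = 1` at `1`. -/
theorem legendre_addition (n : ℕ) :
    legendre n ^ 2 + ∑ m ∈ Finset.range n, C (harmonicWeight n (m + 1)) *
        ((1 - X ^ 2) ^ (m + 1) * derivative^[m + 1] (legendre n) ^ 2) = 1 := by
  have h := derivative_addition_partial_sum n n le_rfl
  rw [iterate_derivative_legendre_eq_zero, mul_zero, mul_zero] at h
  have h1 := eq_C_of_derivative_eq_zero h
  have h2 := congrArg (eval 1) h1
  rw [h1, ← C_1]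
  congr 1
  simpa [eval_finsetSum, legendre_eval_one] using h2.symm

end Legendre

/-! ### Orthogonality of the associated Legendre functions -/

section LegendreIntegral

open Polynomial

theorem integral_eval_derivative (q : ℝ[X]) (a b : ℝ) :
    ∫ x in a..b, (derivative q).eval x = q.eval b - q.eval a :=
  intervalIntegral.integral_eq_sub_of_hasDerivAt (fun x _ => q.hasDerivAt x)
    ((derivative q).continuous.intervalIntegrable _ _)

/-- The integral of `P_n^m P_k^m` over `[-1, 1]`. The two factors `(1 - x^2)^(m/2)` are combined, so
that the integrand is a polynomial. -/
noncomputable def legendreIntegral (m n k : ℕ) : ℝ :=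
  ∫ x in (-1 : ℝ)..1,
    ((1 - X ^ 2) ^ m * derivative^[m] (legendre n) * derivative^[m] (legendre k)).eval x

theorem legendreIntegral_comm (m n k : ℕ) : legendreIntegral m n k = legendreIntegral m k n := by
  simp only [legendreIntegral, mul_right_comm]

/-- Integration by parts lowers the order by one; the boundary terms vanish because of the factor
`(1 - x^2)^(m + 1)`. -/
theorem legendreIntegral_succ (m n k : ℕ) :
    legendreIntegral (m + 1) n k =
      ((n : ℝ) - m) * (n + m + 1) * legendreIntegral m n k := by
  have h := integral_eval_derivative ((1 - X ^ 2) ^ (m + 1) * derivative^[m + 1] (legendre n) *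
    derivative^[m] (legendre k)) (-1) 1
  have h1 (x : ℝ) : (derivative ((1 - X ^ 2) ^ (m + 1) * derivative^[m + 1] (legendre n) *
      derivative^[m] (legendre k))).eval x =
      ((1 - X ^ 2) ^ (m + 1) * derivative^[m + 1] (legendre n) *
        derivative^[m + 1] (legendre k)).eval x -
      ((n : ℝ) - m) * (n + m + 1) * ((1 - X ^ 2) ^ m * derivative^[m] (legendre n) *
        derivative^[m] (legendre k)).eval x := by
    rw [derivative_mul, derivative_weight_mul_legendre,
      ← Function.iterate_succ_apply' derivative m (legendre k)]
    simp only [eval_mul, eval_add, eval_sub, eval_neg, eval_natCast, eval_one]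
    ring
  simp only [h1] at h
  rw [intervalIntegral.integral_sub ((Polynomial.continuous _).intervalIntegrable _ _)
    (((Polynomial.continuous _).intervalIntegrable _ _).const_mul _),
    intervalIntegral.integral_const_mul] at h
  simp only [eval_mul, eval_pow, eval_sub, eval_one, eval_X] at h
  norm_num [-Function.iterate_succ] at h
  rw [legendreIntegral, legendreIntegral]
  simp only [eval_mul, eval_pow, eval_sub, eval_one, eval_X]
  linarith

/-- Lowering the order from `1` to `0` on either factor gives `n (n + 1)` and `k (k + 1)` times the
same integral, which therefore vanishes; this propagates to all orders. -/
theorem legendreIntegral_of_ne (m : ℕ) {n k : ℕ} (h : n ≠ k) : legendreIntegral m n k = 0 := by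
  induction m with
  | zero =>
    have h1 := legendreIntegral_succ 0 n k
    have h2 := legendreIntegral_succ 0 k n
    rw [legendreIntegral_comm, h2, legendreIntegral_comm 0 k n] at h1
    have h3 : ((n : ℝ) - k) * (n + k + 1) * legendreIntegral 0 n k = 0 := by
      push_cast at h1
      linear_combination -h1
    have h4 : (n : ℝ) - k ≠ 0 := sub_ne_zero.2 (by exact_mod_cast h)
    have h5 : (n : ℝ) + k + 1 ≠ 0 := by positivity
    simpa [h4, h5] using h3
  | succ m ih => rw [legendreIntegral_succ, ih, mul_zero]

/-- The weighted norm does not depend on the order `m`. -/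
theorem harmonicWeight_mul_legendreIntegral {n m : ℕ} (h : m ≤ n) :
    harmonicWeight n m * legendreIntegral m n n = 2 * legendreIntegral 0 n n := by
  induction m with
  | zero => rw [harmonicWeight_zero]
  | succ m ih =>
    rw [legendreIntegral_succ, ← ih (by omega), ← harmonicWeight_succ (Nat.lt_of_succ_le h)]
    ring

/-- The norm of `P_n` results from integrating the addition theorem over `[-1, 1]`: each of the `n`
orders `m ≥ 1` contributes twice as much as the order `0`. -/
theorem legendreIntegral_zero_self (n : ℕ) : (2 * n + 1) * legendreIntegral 0 n n = 2 := by
  have h : ∫ x in (-1 : ℝ)..1, (legendre n ^ 2 + ∑ m ∈ Finset.range n,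
      C (harmonicWeight n (m + 1)) *
        ((1 - X ^ 2) ^ (m + 1) * derivative^[m + 1] (legendre n) ^ 2)).eval x = 2 := by
    rw [legendre_addition]
    norm_num
  simp only [eval_add, eval_finsetSum, eval_C_mul] at h
  have hi (q : ℝ[X]) : IntervalIntegrable (fun x => q.eval x) volume (-1) 1 :=
    q.continuous.intervalIntegrable _ _
  rw [intervalIntegral.integral_add (hi _)
      ((continuous_finsetSum _ fun m _ =>
        (Polynomial.continuous _).const_mul _).intervalIntegrable _ _),
    intervalIntegral.integral_finsetSum fun m _ => (hi _).const_mul _] at h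
  have h2 : ∀ m ∈ Finset.range n, (∫ x in (-1 : ℝ)..1, harmonicWeight n (m + 1) *
      ((1 - X ^ 2) ^ (m + 1) * derivative^[m + 1] (legendre n) ^ 2).eval x) =
      2 * legendreIntegral 0 n n := by
    intro m hm
    rw [intervalIntegral.integral_const_mul,
      ← harmonicWeight_mul_legendreIntegral (Finset.mem_range.1 hm), legendreIntegral]
    simp only [pow_two (derivative^[m + 1] (legendre n)), mul_assoc]
  have h3 : (∫ x in (-1 : ℝ)..1, (legendre n ^ 2).eval x) = legendreIntegral 0 n n := by
    simp [legendreIntegral, pow_two]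
  rw [Finset.sum_congr rfl h2, h3] at h
  simp at h
  linarith

end LegendreIntegral

theorem continuous_assocLegendre (n m : ℕ) : Continuous (assocLegendre n m) := by
  unfold assocLegendre
  have := (Polynomial.derivative^[m] (legendre n)).continuous
  fun_prop

theorem assocLegendre_mul (n k m : ℕ) {x : ℝ} (hx : x ∈ Set.Icc (-1) 1) :
    assocLegendre n m x * assocLegendre k m x =
      ((1 - Polynomial.X ^ 2) ^ m * Polynomial.derivative^[m] (legendre n) *
        Polynomial.derivative^[m] (legendre k)).eval x := by
  have h : Real.sqrt (1 - x ^ 2) * Real.sqrt (1 - x ^ 2) = 1 - x ^ 2 :=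
    Real.mul_self_sqrt (by nlinarith [hx.1, hx.2])
  have h1 : Real.sqrt (1 - x ^ 2) ^ m * Real.sqrt (1 - x ^ 2) ^ m = (1 - x ^ 2) ^ m := by
    rw [← mul_pow, h]
  have h2 : (-1 : ℝ) ^ m * (-1) ^ m = 1 := by
    rw [← mul_pow]; norm_num
  simp only [assocLegendre, Polynomial.eval_mul, Polynomial.eval_pow, Polynomial.eval_sub,
    Polynomial.eval_one, Polynomial.eval_X]
  linear_combination
    (Polynomial.derivative^[m] (legendre n)).eval x *
      (Polynomial.derivative^[m] (legendre k)).eval x *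
        ((-1 : ℝ) ^ m * (-1) ^ m * h1 + (1 - x ^ 2) ^ m * h2)

theorem integral_assocLegendre_cos (n k m : ℕ) :
    ∫ θ in (0 : ℝ)..Real.pi, assocLegendre n m (Real.cos θ) * assocLegendre k m (Real.cos θ) *
      Real.sin θ = legendreIntegral m n k := by
  have h := intervalIntegral.integral_comp_mul_deriv (a := 0) (b := Real.pi) (f := Real.cos)
    (f' := fun x => -Real.sin x) (g := fun x => assocLegendre n m x * assocLegendre k m x)
    (fun x _ => Real.hasDerivAt_cos x) (by fun_prop)
    ((continuous_assocLegendre n m).mul (continuous_assocLegendre k m))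
  simp only [Function.comp_def, mul_neg, Real.cos_zero, Real.cos_pi,
    intervalIntegral.integral_neg] at h
  rw [intervalIntegral.integral_symm (-1) 1, neg_inj] at h
  rw [h, legendreIntegral]
  refine intervalIntegral.integral_congr fun x hx => assocLegendre_mul n k m ?_
  rwa [Set.uIcc_of_le (by norm_num)] at hx

/-! ### Orthogonality of the trigonometric functions -/

/-- The dependence of `Y_n^m(θ, φ)` on `φ`, normalized to have mean square one. -/
noncomputable def azimuth (m : ℤ) (φ : ℝ) : ℝ :=
  if m = 0 then 1 else if 0 < m then Real.sqrt 2 * Real.cos (m * φ)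
  else Real.sqrt 2 * Real.sin (m * φ)

theorem continuous_azimuth (m : ℤ) : Continuous (azimuth m) := by
  unfold azimuth
  split_ifs <;> fun_prop

theorem integral_cos_int_mul (m : ℤ) :
    ∫ φ in (-Real.pi)..Real.pi, Real.cos (m * φ) = if m = 0 then 2 * Real.pi else 0 := by
  split_ifs with h
  · simp [h]; ring
  · have h' : (m : ℝ) ≠ 0 := by exact_mod_cast h
    simp [intervalIntegral.integral_comp_mul_left (fun x => Real.cos x) h',
      Real.sin_int_mul_pi]

theorem integral_sin_int_mul (m : ℤ) : ∫ φ in (-Real.pi)..Real.pi, Real.sin (m * φ) = 0 := by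
  rcases eq_or_ne m 0 with h | h
  · simp [h]
  · have h' : (m : ℝ) ≠ 0 := by exact_mod_cast h
    simp [intervalIntegral.integral_comp_mul_left (fun x => Real.sin x) h']

theorem integral_azimuth_mul (m k : ℤ) :
    ∫ φ in (-Real.pi)..Real.pi, azimuth m φ * azimuth k φ =
      if m = k then 2 * Real.pi else 0 := by
  have h2 : Real.sqrt 2 * Real.sqrt 2 = 2 := Real.mul_self_sqrt (by norm_num)
  have hc (j : ℤ) : IntervalIntegrable (fun φ : ℝ => Real.cos (j * φ)) volume
      (-Real.pi) Real.pi := Continuous.intervalIntegrable (by fun_prop) _ _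
  have hs (j : ℤ) : IntervalIntegrable (fun φ : ℝ => Real.sin (j * φ)) volume
      (-Real.pi) Real.pi := Continuous.intervalIntegrable (by fun_prop) _ _
  have hcc : ∫ φ in (-Real.pi)..Real.pi, (Real.sqrt 2 * Real.cos (m * φ)) *
      (Real.sqrt 2 * Real.cos (k * φ)) =
      (if m - k = 0 then 2 * Real.pi else 0) + if m + k = 0 then 2 * Real.pi else 0 := by
    rw [← integral_cos_int_mul, ← integral_cos_int_mul,
      ← intervalIntegral.integral_add (hc _) (hc _)]
    congr 1 with φ
    push_cast
    rw [sub_mul, add_mul, Real.cos_sub, Real.cos_add]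
    linear_combination Real.cos (m * φ) * Real.cos (k * φ) * h2
  have hss : ∫ φ in (-Real.pi)..Real.pi, (Real.sqrt 2 * Real.sin (m * φ)) *
      (Real.sqrt 2 * Real.sin (k * φ)) =
      (if m - k = 0 then 2 * Real.pi else 0) - if m + k = 0 then 2 * Real.pi else 0 := by
    rw [← integral_cos_int_mul, ← integral_cos_int_mul,
      ← intervalIntegral.integral_sub (hc _) (hc _)]
    congr 1 with φ
    push_cast
    rw [sub_mul, add_mul, Real.cos_sub, Real.cos_add]
    linear_combination Real.sin (m * φ) * Real.sin (k * φ) * h2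
  have hsc (a b : ℤ) : ∫ φ in (-Real.pi)..Real.pi, (Real.sqrt 2 * Real.sin (a * φ)) *
      (Real.sqrt 2 * Real.cos (b * φ)) = 0 := by
    have : ∫ φ in (-Real.pi)..Real.pi, (Real.sqrt 2 * Real.sin (a * φ)) *
        (Real.sqrt 2 * Real.cos (b * φ)) = (∫ φ in (-Real.pi)..Real.pi,
          Real.sin ((a + b : ℤ) * φ)) + ∫ φ in (-Real.pi)..Real.pi,
          Real.sin ((a - b : ℤ) * φ) := by
      rw [← intervalIntegral.integral_add (hs _) (hs _)]
      congr 1 with φ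
      push_cast
      rw [sub_mul, add_mul, Real.sin_sub, Real.sin_add]
      linear_combination Real.sin (a * φ) * Real.cos (b * φ) * h2
    rw [this, integral_sin_int_mul, integral_sin_int_mul, add_zero]
  have hcs : ∫ φ in (-Real.pi)..Real.pi, (Real.sqrt 2 * Real.cos (m * φ)) *
      (Real.sqrt 2 * Real.sin (k * φ)) = 0 := by
    rw [← hsc k m]
    simp only [mul_comm]
  unfold azimuth
  split_ifs with h1 h3 h4 h5 h6 h7 h8 h9 h10 h11 h12 h13 <;>
    first
    | omega
    | (simp only [one_mul, mul_one, intervalIntegral.integral_const_mul, integral_cos_int_mul,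
        integral_sin_int_mul, hcc, hss, hsc, intervalIntegral.integral_const]
       try split_ifs
       all_goals first | omega | (simp; try ring))

/-! ### Orthonormality of the spherical harmonics and the addition theorem -/

/-- Separation of variables, in a form that treats all orders `m` alike. -/
theorem sphericalHarmonic_eq (n : ℕ) (m : ℤ) (θ φ : ℝ) :
    sphericalHarmonic n m θ φ = Real.sqrt ((2 * n + 1) * (harmonicWeight n m.natAbs / 2)) *
      assocLegendre n m.natAbs (Real.cos θ) * azimuth m φ := by
  have h : Real.sqrt (2 * (2 * n + 1) * ((n - m.natAbs).factorial : ℝ) /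
      ((n + m.natAbs).factorial : ℝ)) =
      Real.sqrt ((2 * n + 1) * (harmonicWeight n m.natAbs / 2)) * Real.sqrt 2 := by
    rw [← Real.sqrt_mul (mul_nonneg (by positivity) (half_pos (harmonicWeight_pos _ _)).le)]
    congr 1
    unfold harmonicWeight
    ring
  unfold sphericalHarmonic azimuth
  rw [h]
  split_ifs with h0
  · simp [h0, harmonicWeight_zero]
  · ring
  · ring

theorem continuous_regressionVector (d : ℕ) : Continuous (regressionVector d) := by
  refine continuous_pi fun i => ?_
  have h1 := continuous_assocLegendre (i.1 : ℕ) (i.2 : ℤ).natAbs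
  have h2 := continuous_azimuth (i.2 : ℤ)
  simp only [regressionVector, sphericalHarmonic_eq]
  fun_prop

theorem sum_Icc_neg_natCast (n : ℕ) (g : ℤ → ℝ) :
    ∑ m ∈ Finset.Icc (-(n : ℤ)) n, g m =
      g 0 + ∑ m ∈ Finset.range n, (g ((m : ℤ) + 1) + g (-((m : ℤ) + 1))) := by
  induction n with
  | zero => simp
  | succ n ih =>
    have h : Finset.Icc (-((n + 1 : ℕ) : ℤ)) ((n + 1 : ℕ) : ℤ) =
        insert ((n : ℤ) + 1) (insert (-((n : ℤ) + 1)) (Finset.Icc (-(n : ℤ)) n)) := by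
      ext a
      simp only [Finset.mem_insert, Finset.mem_Icc]
      omega
    rw [h, Finset.sum_insert, Finset.sum_insert, ih, Finset.sum_range_succ]
    · ring
    · simp
    · simp only [Finset.mem_insert, Finset.mem_Icc]
      omega

/-- The harmonics of degree `n` have constant square sum `2 n + 1`. -/
theorem sum_sphericalHarmonic_sq (n : ℕ) (θ φ : ℝ) :
    ∑ m ∈ Finset.Icc (-(n : ℤ)) n, sphericalHarmonic n m θ φ ^ 2 = 2 * n + 1 := by
  have hx : Real.cos θ ∈ Set.Icc (-1 : ℝ) 1 := ⟨Real.neg_one_le_cos θ, Real.cos_le_one θ⟩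
  have hs (m : ℕ) : Real.sqrt ((2 * n + 1) * (harmonicWeight n m / 2)) ^ 2 =
      (2 * n + 1) * (harmonicWeight n m / 2) :=
    Real.sq_sqrt (mul_nonneg (by positivity) (half_pos (harmonicWeight_pos _ _)).le)
  have h2 : Real.sqrt 2 ^ 2 = 2 := Real.sq_sqrt (by norm_num)
  have hadd := congrArg (Polynomial.eval (Real.cos θ)) (legendre_addition n)
  simp only [Polynomial.eval_add, Polynomial.eval_finsetSum, Polynomial.eval_C_mul,
    Polynomial.eval_one] at hadd
  have h0 : sphericalHarmonic n 0 θ φ ^ 2 =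
      (2 * n + 1) * (legendre n ^ 2).eval (Real.cos θ) := by
    have h := assocLegendre_mul n n 0 hx
    rw [sphericalHarmonic_eq, mul_pow, mul_pow, Int.natAbs_zero, hs, harmonicWeight_zero, azimuth,
      pow_two (assocLegendre _ _ _), h]
    simp [pow_two]
  have hm (m : ℕ) : sphericalHarmonic n ((m : ℤ) + 1) θ φ ^ 2 +
      sphericalHarmonic n (-((m : ℤ) + 1)) θ φ ^ 2 = (2 * n + 1) * (harmonicWeight n (m + 1) *
        ((1 - Polynomial.X ^ 2) ^ (m + 1) *
          Polynomial.derivative^[m + 1] (legendre n) ^ 2).eval (Real.cos θ)) := by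
    have e1 : ((m : ℤ) + 1).natAbs = m + 1 := by omega
    have e2 : (-((m : ℤ) + 1)).natAbs = m + 1 := by omega
    have e3 : ((m : ℤ) + 1) ≠ 0 := by omega
    have e4 : (0 : ℤ) < m + 1 := by omega
    have e5 : ¬ (0 : ℤ) < -((m : ℤ) + 1) := by omega
    have e6 : -((m : ℤ) + 1) ≠ 0 := by omega
    have h := assocLegendre_mul n n (m + 1) hx
    rw [mul_assoc, ← pow_two, ← pow_two] at h
    rw [← h]
    simp only [sphericalHarmonic_eq, mul_pow, e1, e2, hs, azimuth, e3, e4, e5, e6, if_true,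
      if_false, h2]
    push_cast
    rw [neg_mul, Real.sin_neg, neg_sq]
    linear_combination (2 * n + 1) * harmonicWeight n (m + 1) *
      assocLegendre n (m + 1) (Real.cos θ) ^ 2 * Real.cos_sq_add_sin_sq (((m : ℝ) + 1) * φ)
  rw [sum_Icc_neg_natCast, h0, Finset.sum_congr rfl fun m _ => hm m, ← Finset.mul_sum, ← mul_add,
    hadd, mul_one]

theorem sum_fin_two_mul_add_one (d : ℕ) : ∑ ℓ : Fin (d + 1), (2 * (ℓ : ℕ) + 1) = (d + 1) ^ 2 := by
  rw [Fin.sum_univ_eq_sum_range (fun i => 2 * i + 1)]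
  induction d with
  | zero => rfl
  | succ d ih => rw [Finset.sum_range_succ, ih]; ring

theorem card_index (d : ℕ) : Fintype.card (Index d) = (d + 1) ^ 2 := by
  rw [Fintype.card_sigma, ← sum_fin_two_mul_add_one]
  refine Finset.sum_congr rfl fun ℓ _ => ?_
  simp
  omega

/-- The regression vector has constant Euclidean norm. -/
theorem sum_regressionVector_sq (d : ℕ) (z : ℝ × ℝ) :
    ∑ i, regressionVector d z i ^ 2 = ((d : ℝ) + 1) ^ 2 := by
  have h (ℓ : Fin (d + 1)) : ∑ m : ↥(Finset.Icc (-((ℓ : ℕ) : ℤ)) ((ℓ : ℕ) : ℤ)),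
      regressionVector d z ⟨ℓ, m⟩ ^ 2 = ((2 * (ℓ : ℕ) + 1 : ℕ) : ℝ) := by
    have := sum_sphericalHarmonic_sq (ℓ : ℕ) z.1 z.2
    rw [← Finset.sum_coe_sort] at this
    push_cast
    exact this
  rw [Fintype.sum_sigma, Finset.sum_congr rfl fun ℓ _ => h ℓ, ← Nat.cast_sum,
    sum_fin_two_mul_add_one]
  push_cast
  rfl

theorem measurableSet_designRegion : MeasurableSet designRegion :=
  measurableSet_Icc.prod measurableSet_Ioc

/-- Integration against the uniform distribution splits for products. -/
theorem integral_uniformDesign_mul (f g : ℝ → ℝ) :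
    ∫ z, f z.1 * g z.2 ∂uniformDesign =
      (∫ θ in (0 : ℝ)..Real.pi, f θ * Real.sin θ) *
        (∫ φ in (-Real.pi)..Real.pi, g φ) / (4 * Real.pi) := by
  have hpi := Real.pi_pos
  have hm : Measurable fun z : ℝ × ℝ => ENNReal.ofReal (Real.sin z.1 / (4 * Real.pi)) := by
    fun_prop
  rw [uniformDesign, integral_withDensity_eq_integral_toReal_smul hm (by simp)]
  have h : ∫ z in designRegion, (ENNReal.ofReal (Real.sin z.1 / (4 * Real.pi))).toReal •
      (f z.1 * g z.2) = ∫ z in designRegion,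
        (f z.1 * Real.sin z.1) * (g z.2 / (4 * Real.pi)) := by
    refine setIntegral_congr_fun measurableSet_designRegion fun z hz => ?_
    have hs : 0 ≤ Real.sin z.1 := Real.sin_nonneg_of_mem_Icc hz.1
    simp only [smul_eq_mul]
    rw [ENNReal.toReal_ofReal (by positivity)]
    ring
  rw [h, designRegion, Measure.volume_eq_prod,
    setIntegral_prod_mul (fun θ => f θ * Real.sin θ) (fun φ => g φ / (4 * Real.pi)),
    integral_Icc_eq_integral_Ioc, ← intervalIntegral.integral_of_le hpi.le,
    ← intervalIntegral.integral_of_le (by linarith), intervalIntegral.integral_div]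
  ring

theorem isDesign_uniformDesign : IsDesign uniformDesign := by
  have hpi := Real.pi_pos
  refine ⟨⟨?_⟩, ?_⟩
  · have h := integral_uniformDesign_mul (fun _ => 1) (fun _ => 1)
    simp at h
    have h4 : Real.pi * 4 ≠ 0 := by positivity
    rw [← ENNReal.toReal_eq_one_iff, ← Measure.real, h]
    field_simp
    norm_num
  · rw [uniformDesign, withDensity_apply _ measurableSet_designRegion.compl,
      Measure.restrict_restrict measurableSet_designRegion.compl]
    simp

theorem integral_sphericalHarmonic_mul {n k : ℕ} {m j : ℤ} (hm : m.natAbs ≤ n) :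
    ∫ z, sphericalHarmonic n m z.1 z.2 * sphericalHarmonic k j z.1 z.2 ∂uniformDesign =
      if n = k ∧ m = j then 1 else 0 := by
  have hpi := Real.pi_pos
  have h (z : ℝ × ℝ) : sphericalHarmonic n m z.1 z.2 * sphericalHarmonic k j z.1 z.2 =
      (Real.sqrt ((2 * n + 1) * (harmonicWeight n m.natAbs / 2)) *
        Real.sqrt ((2 * k + 1) * (harmonicWeight k j.natAbs / 2)) *
          (assocLegendre n m.natAbs (Real.cos z.1) * assocLegendre k j.natAbs (Real.cos z.1))) *
        (azimuth m z.2 * azimuth j z.2) := by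
    rw [sphericalHarmonic_eq, sphericalHarmonic_eq]
    ring
  simp only [h]
  rw [integral_uniformDesign_mul (fun θ =>
    Real.sqrt ((2 * n + 1) * (harmonicWeight n m.natAbs / 2)) *
      Real.sqrt ((2 * k + 1) * (harmonicWeight k j.natAbs / 2)) *
        (assocLegendre n m.natAbs (Real.cos θ) * assocLegendre k j.natAbs (Real.cos θ)))
    (fun φ => azimuth m φ * azimuth j φ), integral_azimuth_mul]
  rcases eq_or_ne m j with rfl | hmj
  · simp only [mul_assoc _ (_ * _) (Real.sin _), intervalIntegral.integral_const_mul,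
      integral_assocLegendre_cos]
    rcases eq_or_ne n k with rfl | hnk
    · rw [Real.mul_self_sqrt (mul_nonneg (by positivity) (half_pos (harmonicWeight_pos _ _)).le)]
      have h1 := harmonicWeight_mul_legendreIntegral hm
      have h2 := legendreIntegral_zero_self n
      simp only [and_self, if_true]
      rw [div_eq_one_iff_eq (by positivity)]
      linear_combination Real.pi * (2 * n + 1) * h1 + 2 * Real.pi * h2
    · simp [legendreIntegral_of_ne _ hnk, hnk]
  · simp [hmj]

/-- The spherical harmonics are orthonormal for the uniform distribution. -/
theorem infoMatrix_uniformDesign (d : ℕ) : infoMatrix d uniformDesign = 1 := by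
  ext ⟨ℓ, m, hm⟩ ⟨k, j, hj⟩
  rw [Finset.mem_Icc] at hm
  rw [infoMatrix, Matrix.of_apply, Matrix.one_apply]
  simp only [regressionVector]
  rw [integral_sphericalHarmonic_mul (by omega)]
  refine if_congr ⟨?_, ?_⟩ rfl rfl
  · rintro ⟨h1, rfl⟩
    obtain rfl := Fin.ext h1
    rfl
  · intro h
    obtain ⟨rfl, h⟩ := Sigma.mk.inj_iff.1 h
    simpa using h

/-! ### The spectrum of an information matrix -/

section Spectrum

variable {ι : Type*} [Fintype ι] [DecidableEq ι] {A : Matrix ι ι ℝ}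

theorem exists_eigenvalues_eq_eigenvalues₀ (hA : A.IsHermitian) (k : Fin (Fintype.card ι)) :
    ∃ i, hA.eigenvalues i = hA.eigenvalues₀ k :=
  ⟨Fintype.equivOfCardEq (Fintype.card_fin _) k, by simp [Matrix.IsHermitian.eigenvalues]⟩

theorem nthSmallestEigenvalue_nonneg (hA : A.PosSemidef) (j : ℕ) :
    0 ≤ nthSmallestEigenvalue hA.1 j := by
  unfold nthSmallestEigenvalue
  split_ifs with h
  · obtain ⟨i, hi⟩ := exists_eigenvalues_eq_eigenvalues₀ hA.1 ⟨Fintype.card ι - j, by omega⟩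
    exact hi ▸ hA.eigenvalues_nonneg i
  · exact le_rfl

theorem nthSmallestEigenvalue_mono (hA : A.IsHermitian) {j k : ℕ} (hj : 1 ≤ j) (hjk : j ≤ k)
    (hk : k ≤ Fintype.card ι) : nthSmallestEigenvalue hA j ≤ nthSmallestEigenvalue hA k := by
  unfold nthSmallestEigenvalue
  rw [dif_pos ⟨hj, hjk.trans hk⟩, dif_pos ⟨hj.trans hjk, hk⟩]
  refine hA.eigenvalues₀_antitone ?_
  rw [Fin.mk_le_mk]
  omega

theorem sum_nthSmallestEigenvalue (hA : A.IsHermitian) :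
    ∑ j ∈ Finset.Icc 1 (Fintype.card ι), nthSmallestEigenvalue hA j = A.trace := by
  have h1 : A.trace = ∑ k, hA.eigenvalues₀ k := by
    rw [hA.trace_eq_sum_eigenvalues]
    exact Equiv.sum_comp (Fintype.equivOfCardEq (Fintype.card_fin _)).symm hA.eigenvalues₀
  rw [h1]
  symm
  refine Finset.sum_bij (fun k _ => Fintype.card ι - k) ?_ ?_ ?_ ?_
  · intro k _
    have := k.2
    rw [Finset.mem_Icc]
    omega
  · intro a _ b _ h
    have := a.2
    have := b.2
    apply Fin.ext
    omega
  · intro j hj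
    rw [Finset.mem_Icc] at hj
    exact ⟨⟨Fintype.card ι - j, by omega⟩, Finset.mem_univ _, by
      change Fintype.card ι - (Fintype.card ι - j) = j
      omega⟩
  · intro k _
    have := k.2
    rw [nthSmallestEigenvalue, dif_pos (by omega)]
    congr 1
    apply Fin.ext
    change (k : ℕ) = Fintype.card ι - (Fintype.card ι - k)
    omega

theorem nthSmallestEigenvalue_eq_one (hA : A.IsHermitian) (h : A = 1) {j : ℕ} (hj : 1 ≤ j)
    (hjc : j ≤ Fintype.card ι) : nthSmallestEigenvalue hA j = 1 := by
  rw [nthSmallestEigenvalue, dif_pos ⟨hj, hjc⟩]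
  obtain ⟨i, hi⟩ := exists_eigenvalues_eq_eigenvalues₀ hA ⟨Fintype.card ι - j, by omega⟩
  rw [← hi]
  have : Nonempty ι := ⟨i⟩
  have h1 := hA.eigenvalues_mem_spectrum_real i
  have h2 : spectrum ℝ A = {1} := by rw [h, spectrum.one_eq]
  rwa [h2, Set.mem_singleton_iff] at h1

/-- If the mean of all eigenvalues is one, then the mean of the `r` smallest ones is at most one. -/
theorem sum_nthSmallestEigenvalue_le (hA : A.IsHermitian) (htr : A.trace = Fintype.card ι)
    {r : ℕ} (hr : 1 ≤ r) (hrc : r ≤ Fintype.card ι) :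
    ∑ j ∈ Finset.Icc 1 r, nthSmallestEigenvalue hA j ≤ r := by
  rcases le_total (nthSmallestEigenvalue hA r) 1 with h | h
  · have := Finset.sum_le_card_nsmul (Finset.Icc 1 r) (nthSmallestEigenvalue hA) 1 fun j hj => by
      rw [Finset.mem_Icc] at hj
      exact (nthSmallestEigenvalue_mono hA hj.1 hj.2 hrc).trans h
    simpa using this
  · have h1 : ∑ j ∈ Finset.Icc 1 r, nthSmallestEigenvalue hA j +
        ∑ j ∈ Finset.Ioc r (Fintype.card ι), nthSmallestEigenvalue hA j = Fintype.card ι := by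
      rw [← htr, ← sum_nthSmallestEigenvalue hA, ← Finset.sum_union]
      · congr 1
        ext j
        simp only [Finset.mem_union, Finset.mem_Icc, Finset.mem_Ioc]
        omega
      · refine Finset.disjoint_left.2 fun j h1 h2 => ?_
        simp only [Finset.mem_Icc, Finset.mem_Ioc] at h1 h2
        omega
    have h2 := Finset.card_nsmul_le_sum (Finset.Ioc r (Fintype.card ι))
      (nthSmallestEigenvalue hA) 1 fun j hj => by
        rw [Finset.mem_Ioc] at hj
        exact h.trans (nthSmallestEigenvalue_mono hA hr hj.1.le hj.2)
    rw [Nat.card_Ioc, nsmul_eq_mul, Nat.cast_sub hrc] at h2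
    linarith

end Spectrum

theorem integrable_regressionVector_mul (d : ℕ) {ξ : Measure (ℝ × ℝ)} (hξ : IsDesign ξ)
    (i j : Index d) :
    Integrable (fun z => regressionVector d z i * regressionVector d z j) ξ := by
  have := hξ.isProbabilityMeasure
  have hc (i : Index d) : Continuous fun z => regressionVector d z i :=
    (continuous_apply i).comp (continuous_regressionVector d)
  refine Integrable.of_bound ((hc i).mul (hc j)).aestronglyMeasurable (((d : ℝ) + 1) ^ 2)
    (Filter.Eventually.of_forall fun z => ?_)
  have hi (i : Index d) : |regressionVector d z i| ≤ (d : ℝ) + 1 := by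
    refine abs_le_of_sq_le_sq ?_ (by positivity)
    rw [← sum_regressionVector_sq d z]
    exact Finset.single_le_sum (f := fun i => regressionVector d z i ^ 2)
      (fun k _ => sq_nonneg _) (Finset.mem_univ i)
  rw [Real.norm_eq_abs, abs_mul, pow_two]
  exact mul_le_mul (hi i) (hi j) (abs_nonneg _) (by positivity)

theorem posSemidef_infoMatrix (d : ℕ) {ξ : Measure (ℝ × ℝ)} (hξ : IsDesign ξ) :
    (infoMatrix d ξ).PosSemidef := by
  refine Matrix.PosSemidef.of_dotProduct_mulVec_nonneg (infoMatrix_isHermitian d ξ) fun x => ?_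
  have hint (i j : Index d) := integrable_regressionVector_mul d hξ i j
  have h : star x ⬝ᵥ (infoMatrix d ξ).mulVec x =
      ∫ z, (∑ i, x i * regressionVector d z i) ^ 2 ∂ξ := by
    have h1 (z : ℝ × ℝ) : (∑ i, x i * regressionVector d z i) ^ 2 =
        ∑ i, ∑ j, x i * (regressionVector d z i * regressionVector d z j * x j) := by
      rw [pow_two, Finset.sum_mul_sum]
      exact Finset.sum_congr rfl fun i _ => Finset.sum_congr rfl fun j _ => by ring
    simp only [h1]
    rw [integral_finsetSum _ fun i _ => integrable_finsetSum _ fun j _ =>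
      ((hint i j).mul_const _).const_mul _]
    refine Finset.sum_congr rfl fun i _ => ?_
    rw [integral_finsetSum _ fun j _ => ((hint i j).mul_const _).const_mul _]
    simp only [integral_const_mul, integral_mul_const, ← Finset.mul_sum]
    rfl
  rw [h]
  exact integral_nonneg fun z => sq_nonneg _

/-- By the addition theorem all information matrices have the same trace. -/
theorem trace_infoMatrix (d : ℕ) {ξ : Measure (ℝ × ℝ)} (hξ : IsDesign ξ) :
    (infoMatrix d ξ).trace = Fintype.card (Index d) := by
  have := hξ.isProbabilityMeasure
  have h : (infoMatrix d ξ).trace = ∫ z, ∑ i, regressionVector d z i ^ 2 ∂ξ := by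
    simp only [pow_two]
    rw [integral_finsetSum _ fun i _ => integrable_regressionVector_mul d hξ i i]
    rfl
  simp [h, sum_regressionVector_sq, -Fintype.card_sigma, card_index]

/-! ### Optimality -/

theorem lam_uniformDesign (d : ℕ) {j : ℕ} (hj : 1 ≤ j) (hjd : j ≤ (d + 1) ^ 2) :
    lam d uniformDesign j = 1 := by
  rw [lam, nthSmallestEigenvalue_eq_one _ (infoMatrix_uniformDesign d) hj (by rwa [card_index]),
    ENNReal.ofReal_one]

section PowerMean

variable {s : Finset ℕ} {l : ℕ → ℝ}

/-- The inequality between the geometric and the arithmetic mean, for mean at most one. -/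
theorem prod_le_one_of_sum_le_card (hl : ∀ j ∈ s, 0 ≤ l j) (hs : ∑ j ∈ s, l j ≤ s.card) :
    ∏ j ∈ s, l j ≤ 1 := by
  calc ∏ j ∈ s, l j ≤ ∏ j ∈ s, Real.exp (l j - 1) :=
        Finset.prod_le_prod hl fun j _ => by linarith [Real.add_one_le_exp (l j - 1)]
    _ = Real.exp (∑ j ∈ s, l j - s.card) := by
        rw [← Real.exp_sum, Finset.sum_sub_distrib]; simp
    _ ≤ 1 := Real.exp_le_one_iff.2 (by linarith)

/-- The tangent of the concave function `x ^ q` at `1` lies above its graph. -/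
theorem sum_rpow_le_card (hl : ∀ j ∈ s, 0 ≤ l j) (hs : ∑ j ∈ s, l j ≤ s.card) {q : ℝ}
    (hq0 : 0 ≤ q) (hq1 : q ≤ 1) : ∑ j ∈ s, l j ^ q ≤ s.card := by
  calc ∑ j ∈ s, l j ^ q ≤ ∑ j ∈ s, (1 + q * (l j - 1)) := Finset.sum_le_sum fun j hj => by
        simpa using rpow_one_add_le_one_add_mul_self (s := l j - 1)
          (by linarith [hl j hj]) hq0 hq1
    _ = s.card + q * (∑ j ∈ s, l j - s.card) := by
        rw [Finset.sum_add_distrib, ← Finset.mul_sum, Finset.sum_sub_distrib]; simp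
    _ ≤ s.card := by nlinarith

/-- The tangent of the convex function `x ^ q` at `1` lies below its graph. -/
theorem card_le_sum_rpow (hl : ∀ j ∈ s, 0 < l j) (hs : ∑ j ∈ s, l j ≤ s.card) {q : ℝ}
    (hq : q ≤ 0) : (s.card : ℝ) ≤ ∑ j ∈ s, l j ^ q := by
  calc (s.card : ℝ) ≤ s.card + q * (∑ j ∈ s, l j - s.card) := by nlinarith
    _ = ∑ j ∈ s, (1 + q * (l j - 1)) := by
        rw [Finset.sum_add_distrib, ← Finset.mul_sum, Finset.sum_sub_distrib]; simp
    _ ≤ ∑ j ∈ s, l j ^ q := Finset.sum_le_sum fun j hj => by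
        rw [Real.rpow_def_of_pos (hl j hj)]
        nlinarith [Real.add_one_le_exp (Real.log (l j) * q),
          Real.log_le_sub_one_of_pos (hl j hj)]

end PowerMean

/-- Every eigenvalue of the uniform design is one, so the claim is that the mean of exponent `p` of
the `r` smallest eigenvalues is at most one, which follows from the same bound for their arithmetic
mean. -/
theorem Psi_le_Psi_uniformDesign (d r : ℕ) (p : EReal) (hp : p < 1) (hr : 1 ≤ r)
    (hrd : r ≤ (d + 1) ^ 2) {ξ : Measure (ℝ × ℝ)} (hξ : IsDesign ξ) :
    Psi d p r ξ ≤ Psi d p r uniformDesign := by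
  set l : ℕ → ℝ := nthSmallestEigenvalue (infoMatrix_isHermitian d ξ)
  have hlam (j : ℕ) : lam d ξ j = ENNReal.ofReal (l j) := rfl
  have hl0 (j : ℕ) : 0 ≤ l j := nthSmallestEigenvalue_nonneg (posSemidef_infoMatrix d hξ) j
  have hsum {k : ℕ} (hk : 1 ≤ k) (hkd : k ≤ (d + 1) ^ 2) : ∑ j ∈ Finset.Icc 1 k, l j ≤ k :=
    sum_nthSmallestEigenvalue_le _ (trace_infoMatrix d hξ) hk (by rwa [card_index])
  have hs : ∑ j ∈ Finset.Icc 1 r, l j ≤ (Finset.Icc 1 r).card := by simpa using hsum hr hrd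
  have hu : ∀ j ∈ Finset.Icc 1 r, lam d uniformDesign j = 1 := fun j hj => by
    rw [Finset.mem_Icc] at hj
    exact lam_uniformDesign d hj.1 (hj.2.trans hrd)
  unfold Psi
  split_ifs with h1 h2
  · rw [lam_uniformDesign d le_rfl (hr.trans hrd), hlam, ENNReal.ofReal_le_one]
    simpa using hsum le_rfl (hr.trans hrd)
  · rw [Finset.prod_congr rfl hu, Finset.prod_const_one]
    simp only [hlam]
    rw [← ENNReal.ofReal_prod_of_nonneg fun j _ => hl0 j, ENNReal.ofReal_le_one]
    exact prod_le_one_of_sum_le_card (fun j _ => hl0 j) hs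
  · have hsu : ∑ j ∈ Finset.Icc 1 r, lam d uniformDesign j ^ p.toReal =
        ENNReal.ofReal (Finset.Icc 1 r).card := by
      rw [Finset.sum_congr rfl fun j hj => by rw [hu j hj, ENNReal.one_rpow]]
      simp
    rw [hsu]
    lift p to ℝ using ⟨(hp.trans (EReal.coe_lt_top 1)).ne, h1⟩ with q
    rw [EReal.toReal_coe]
    have hq0 : q ≠ 0 := by exact_mod_cast h2
    have hq1 : q < 1 := by exact_mod_cast hp
    rcases lt_or_gt_of_ne hq0 with hq | hq
    · rw [← ENNReal.inv_le_inv, ← ENNReal.rpow_neg, ← ENNReal.rpow_neg]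
      refine ENNReal.rpow_le_rpow ?_ (neg_nonneg.2 (one_div_nonpos.2 hq.le))
      by_cases hz : ∃ j ∈ Finset.Icc 1 r, l j = 0
      · -- a singular information matrix contributes the term `0 ^ q = ∞`
        obtain ⟨j, hj, hj0⟩ := hz
        have : ∑ j ∈ Finset.Icc 1 r, lam d ξ j ^ q = ⊤ :=
          ENNReal.sum_eq_top.2 ⟨j, hj, by simp [hlam, hj0, hq]⟩
        rw [this]
        exact le_top
      · push Not at hz
        have hpos : ∀ j ∈ Finset.Icc 1 r, 0 < l j := fun j hj =>
          lt_of_le_of_ne (hl0 j) (hz j hj).symm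
        rw [Finset.sum_congr rfl fun j hj => by
          rw [hlam, ENNReal.ofReal_rpow_of_pos (hpos j hj)],
          ← ENNReal.ofReal_sum_of_nonneg fun j _ => Real.rpow_nonneg (hl0 j) _]
        exact ENNReal.ofReal_le_ofReal (card_le_sum_rpow hpos hs hq.le)
    · refine ENNReal.rpow_le_rpow ?_ (one_div_nonneg.2 hq.le)
      rw [Finset.sum_congr rfl fun j hj => by
        rw [hlam, ENNReal.ofReal_rpow_of_nonneg (hl0 j) hq.le],
        ← ENNReal.ofReal_sum_of_nonneg fun j _ => Real.rpow_nonneg (hl0 j) _]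
      exact ENNReal.ofReal_le_ofReal (sum_rpow_le_card (fun j _ => hl0 j) hs hq.le hq1.le)

end SphericalDesign

theorem corollary2p2 (d r : ℕ) (p : EReal) (hp : p < 1) (hr : 1 ≤ r) (hrd : r ≤ (d + 1) ^ 2) :
    SphericalDesign.IsPsiOptimal d p r SphericalDesign.uniformDesign :=
  ⟨SphericalDesign.isDesign_uniformDesign, fun _ hξ =>
    SphericalDesign.Psi_le_Psi_uniformDesign d r p hp hr hrd hξ⟩
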